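/- Let $D$ be an integral domain with quotient field $K$. For a nonzero fractional ideal $I$ of $D$ put $I^{-1}=\{x\in K: xI\subseteq D\}$, $I_v=(I^{-1})^{-1}$ and $I_t=\bigcup\{J_v : J\subseteq I \text{ a nonzero finitely generated fractional ideal}\}$. Call $I$ a $t$-ideal if $I_t=I$, and $t$-invertible if $(II^{-1})_t=D$. The $t$-class group $Cl_t(D)$ is the group of $t$-invertible fractional $t$-ideals under $I\ast J=(IJ)_t$, modulo the subgroup of nonzero principal fractional ideals. A packet of $D$ is an integral $t$-invertible $t$-ideal of $D$ whose radical is prime. Integral ideals $I,J$ are $t$-comaximal if $(I+J)_t=D$. The domain $D$ is a unique representation domain (URD) if every proper integral $t$-invertible $t$-ideal $I$ of $D$ can be written, uniquely up to order, as $I=(I_1\cdots I_n)_t$ with pairwise $t$-comaximal packets $I_1,\dots,I_n$. The domain $D$ is an almost GCD (AGCD) domain if for all nonzero $a,b\in D$ there is an integer $n\ge 1$ such that $(a^n)\cap(b^n)$ is principal. It is Archimedean if $\bigcap_{n\ge1}(x^n)=(0)$ for every nonunit $x\in D$. It is completely integrally closed if, whenever $x\in K$ and $0\ne r\in D$ satisfy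 $rx^n\in D$ for every $n\ge1$, then $x\in D$. Valuation domains below are valuation rings with quotient field $K$; the rank is the Krull dimension, and the intersection of the empty family is $K$. A family of valuation domains containing $D$ is locally finite if every nonzero element of $D$ is a nonunit in only finitely many of them. The domain $D$ is a generalized Krull domain if it is the intersection of a locally finite family of rank-one valuation domains each of the form $D_P$ with $P$ a prime ideal of $D$. It is an almost GUFD if it is a generalized Krull domain and $Cl_t(D)$ is a torsion group. Theorem. Let $D$ be an AGCD domain that is also a URD. The following statements are equivalent. 1. $D$ is a locally finite intersection of rank-one valuation domains. 2. $D$ is an intersection of rank-one valuation domains. 3. $D$ is completely integrally closed. 4. $D[[X]]$ is integrally closed. 5. $D$ is integrally closed and Archimedean. 6. $D$ is integrally closed and every packet of $D$ is contained in a height-one prime ideal of $D$. 7. $D$ is an almost GUFD. -/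

import Mathlib

open scoped nonZeroDivisors

noncomputable section

/-! Throughout, `D` is an integral domain with quotient field `K`, and fractional ideals of `D` are
elements of `FractionalIdeal D⁰ K`.  For `I ≠ 0`, `I⁻¹ = {x ∈ K | x I ⊆ D}`. -/

namespace FractionalIdeal

variable {D K : Type*} [CommRing D] [IsDomain D] [Field K] [Algebra D K] [IsFractionRing D K]

/-- The `v`-closure `I_v = (I⁻¹)⁻¹` of a fractional ideal (with `0_v = 0`). -/
def vClosure (I : FractionalIdeal D⁰ K) : FractionalIdeal D⁰ K := (I⁻¹)⁻¹

theorem inv_ne_zero_of_ne_zero {I : FractionalIdeal D⁰ K} (hI : I ≠ 0) : I⁻¹ ≠ 0 := by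
  intro h
  have h1 := den_mem_inv hI
  rw [h, mem_zero_iff] at h1
  exact nonZeroDivisors.coe_ne_zero I.den (IsFractionRing.injective D K (by rw [h1, map_zero]))

theorem le_vClosure (I : FractionalIdeal D⁰ K) : I ≤ I.vClosure := by
  by_cases hI : I = 0
  · simp [hI]
  · intro x hx
    exact (mem_inv_iff (inv_ne_zero_of_ne_zero hI)).2 fun y hy => by
      rw [mul_comm]; exact (mem_inv_iff hI).1 hy x hx

theorem vClosure_zero : (0 : FractionalIdeal D⁰ K).vClosure = 0 := by
  simp [vClosure, inv_zero']

theorem vClosure_mono {I J : FractionalIdeal D⁰ K} (h : I ≤ J) : I.vClosure ≤ J.vClosure := by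
  by_cases hI : I = 0
  · simp [hI, vClosure_zero]
  · have hJ : J ≠ 0 := fun h0 => hI (le_zero_iff.1 (h0 ▸ h))
    exact inv_anti_mono (inv_ne_zero_of_ne_zero hJ) (inv_ne_zero_of_ne_zero hI)
      (inv_anti_mono hI hJ h)

theorem vClosure_inv (I : FractionalIdeal D⁰ K) : I⁻¹.vClosure = I⁻¹ := by
  by_cases hI : I = 0
  · simp [hI, inv_zero', vClosure_zero]
  · refine le_antisymm ?_ (le_vClosure _)
    exact inv_anti_mono hI (inv_ne_zero_of_ne_zero (inv_ne_zero_of_ne_zero hI)) (le_vClosure I)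

theorem vClosure_vClosure (I : FractionalIdeal D⁰ K) : I.vClosure.vClosure = I.vClosure :=
  vClosure_inv _

theorem mul_mem_vClosure {I J : FractionalIdeal D⁰ K} {x y : K} (hx : x ∈ I)
    (hy : y ∈ J.vClosure) : x * y ∈ (I * J).vClosure := by
  by_cases hI : I = 0
  · subst hI
    rw [mem_zero_iff] at hx
    simpa [hx] using zero_mem _
  by_cases hJ : J = 0
  · subst hJ
    rw [vClosure_zero, mem_zero_iff] at hy
    simpa [hy] using zero_mem _
  have hIJ : I * J ≠ 0 := by
    intro h0
    obtain ⟨a, ha, ha0⟩ : ∃ a ∈ I, a ≠ 0 := by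
      by_contra! h
      exact hI (eq_zero_iff.2 h)
    refine hJ (eq_zero_iff.2 fun b hb => ?_)
    have h1 : a * b ∈ I * J := mul_mem_mul ha hb
    rw [h0, mem_zero_iff] at h1
    exact (mul_eq_zero.1 h1).resolve_left ha0
  refine (mem_inv_iff (inv_ne_zero_of_ne_zero hIJ)).2 fun z hz => ?_
  have h1 : x * z ∈ J⁻¹ := (mem_inv_iff hJ).2 fun w hw => by
    have := (mem_inv_iff hIJ).1 hz (x * w) (mul_mem_mul hx hw)
    rwa [mul_assoc, mul_left_comm]
  have := (mem_inv_iff (inv_ne_zero_of_ne_zero hJ)).1 hy _ h1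
  rwa [mul_comm x y, mul_assoc]

/-- The `t`-closure `I_t = ⋃ {J_v | J ⊆ I finitely generated}` of a fractional ideal. -/
def tClosure (I : FractionalIdeal D⁰ K) : FractionalIdeal D⁰ K :=
  ⟨{ carrier := {x | ∃ J : FractionalIdeal D⁰ K,
        (J : Submodule D K).FG ∧ J ≤ I ∧ x ∈ J.vClosure}
     add_mem' := by
      rintro x y ⟨J, hJ, hJI, hx⟩ ⟨J', hJ', hJI', hy⟩
      refine ⟨J ⊔ J', by simpa using hJ.sup hJ', sup_le hJI hJI', ?_⟩
      exact (J ⊔ J').vClosure.val.add_mem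
        (vClosure_mono le_sup_left hx) (vClosure_mono le_sup_right hy)
     zero_mem' := ⟨0, by simpa using Submodule.fg_bot, zero_le _, zero_mem _⟩
     smul_mem' := by
      rintro c x ⟨J, hJ, hJI, hx⟩
      exact ⟨J, hJ, hJI, J.vClosure.val.smul_mem c hx⟩ }, by
    obtain ⟨a, ha, h⟩ := I.vClosure.isFractional
    exact ⟨a, ha, fun b ⟨J, _, hJI, hb⟩ => h b (vClosure_mono hJI hb)⟩⟩

theorem mem_tClosure {I : FractionalIdeal D⁰ K} {x : K} :
    x ∈ I.tClosure ↔ ∃ J : FractionalIdeal D⁰ K,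
      (J : Submodule D K).FG ∧ J ≤ I ∧ x ∈ J.vClosure := Iff.rfl

theorem tClosure_le_vClosure (I : FractionalIdeal D⁰ K) : I.tClosure ≤ I.vClosure := by
  rintro x ⟨J, -, hJI, hx⟩
  exact vClosure_mono hJI hx

theorem le_tClosure (I : FractionalIdeal D⁰ K) : I ≤ I.tClosure := by
  intro x hx
  refine ⟨spanSingleton D⁰ x, ?_, spanSingleton_le_iff_mem.2 hx,
    le_vClosure _ (mem_spanSingleton_self _ x)⟩
  rw [coe_spanSingleton]
  exact Submodule.fg_span_singleton x

theorem tClosure_mono {I J : FractionalIdeal D⁰ K} (h : I ≤ J) : I.tClosure ≤ J.tClosure :=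
  fun _ ⟨L, hL, hLI, hx⟩ => ⟨L, hL, hLI.trans h, hx⟩

theorem exists_fg_of_le_tClosure {I J : FractionalIdeal D⁰ K} (hJ : (J : Submodule D K).FG)
    (h : J ≤ I.tClosure) :
    ∃ L : FractionalIdeal D⁰ K, (L : Submodule D K).FG ∧ L ≤ I ∧ J ≤ L.vClosure := by
  obtain ⟨s, hs⟩ := hJ
  have key : ∀ s : Finset K, (∀ x ∈ s, x ∈ I.tClosure) →
      ∃ L : FractionalIdeal D⁰ K, (L : Submodule D K).FG ∧ L ≤ I ∧ ∀ x ∈ s, x ∈ L.vClosure := by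
    intro s
    classical
    induction s using Finset.induction_on with
    | empty => exact fun _ => ⟨0, by simpa using Submodule.fg_bot, zero_le _, by simp⟩
    | insert a s _ ih =>
      intro h
      obtain ⟨L, hL, hLI, hx⟩ := ih fun x hx => h x (Finset.mem_insert_of_mem hx)
      obtain ⟨L', hL', hLI', hx'⟩ := h a (Finset.mem_insert_self a s)
      refine ⟨L ⊔ L', by simpa using hL.sup hL', sup_le hLI hLI', fun x hxs => ?_⟩
      rcases Finset.mem_insert.1 hxs with rfl | hxs
      · exact vClosure_mono le_sup_right hx'
      · exact vClosure_mono le_sup_left (hx x hxs)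
  obtain ⟨L, hL, hLI, hx⟩ := key s fun x hx => h (show x ∈ (J : Submodule D K) from
    hs ▸ Submodule.subset_span hx)
  refine ⟨L, hL, hLI, ?_⟩
  rw [← coe_le_coe, ← hs]
  exact Submodule.span_le.2 hx

theorem tClosure_tClosure (I : FractionalIdeal D⁰ K) : I.tClosure.tClosure = I.tClosure := by
  refine le_antisymm ?_ (le_tClosure _)
  rintro x ⟨J, hJ, hJI, hx⟩
  obtain ⟨L, hL, hLI, hJL⟩ := exists_fg_of_le_tClosure hJ hJI
  exact ⟨L, hL, hLI, vClosure_vClosure L ▸ vClosure_mono hJL hx⟩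

theorem tClosure_mul_tClosure (I J : FractionalIdeal D⁰ K) :
    (I * J.tClosure).tClosure = (I * J).tClosure := by
  refine le_antisymm ?_ (tClosure_mono (mul_le_mul_right (le_tClosure J) I))
  rw [← tClosure_tClosure (I * J)]
  refine tClosure_mono (FractionalIdeal.mul_le.2 ?_)
  rintro x hx y ⟨L, hL, hLJ, hy⟩
  refine ⟨spanSingleton D⁰ x * L, ?_, ?_, mul_mem_vClosure (mem_spanSingleton_self _ x) hy⟩
  · rw [coe_mul, coe_spanSingleton]
    exact (Submodule.fg_span_singleton x).mul hL
  · exact mul_le_mul' (spanSingleton_le_iff_mem.2 hx) hLJ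

theorem tClosure_inv (I : FractionalIdeal D⁰ K) : I⁻¹.tClosure = I⁻¹ :=
  le_antisymm ((tClosure_le_vClosure _).trans (vClosure_inv I).le) (le_tClosure _)

theorem tClosure_spanSingleton (x : K) :
    (spanSingleton D⁰ x).tClosure = spanSingleton D⁰ x := by
  simpa [spanSingleton_inv] using tClosure_inv (spanSingleton D⁰ x⁻¹)

theorem tClosure_one : (1 : FractionalIdeal D⁰ K).tClosure = 1 := by
  simpa using tClosure_spanSingleton (D := D) (1 : K)

/-- `I` is a `t`-ideal: `I_t = I`. -/
def IsTIdeal (I : FractionalIdeal D⁰ K) : Prop := I.tClosure = I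

/-- `I` is `t`-invertible: `(I I⁻¹)_t = D`.  Such an `I` is nonzero, since `0⁻¹ = 0`. -/
def IsTInvertible (I : FractionalIdeal D⁰ K) : Prop := (I * I⁻¹).tClosure = 1

variable (D K) in
/-- The set `t-inv(D)` of `t`-invertible fractional `t`-ideals. -/
@[ext]
structure TInv where
  /-- The underlying fractional ideal. -/
  val : FractionalIdeal D⁰ K
  isTIdeal : val.IsTIdeal
  isTInvertible : val.IsTInvertible

theorem IsTInvertible.ne_zero {I : FractionalIdeal D⁰ K} (h : I.IsTInvertible) : I ≠ 0 := by
  rintro rfl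
  have : (0 : FractionalIdeal D⁰ K).tClosure = 0 :=
    le_antisymm ((tClosure_le_vClosure _).trans vClosure_zero.le) (zero_le _)
  rw [IsTInvertible, zero_mul, this] at h
  exact zero_ne_one h

/-- If `(I J)_t = D` for some `J`, then `I` is `t`-invertible. -/
theorem isTInvertible_of_mul {I J : FractionalIdeal D⁰ K} (h : (I * J).tClosure = 1) :
    I.IsTInvertible := by
  have hI : I ≠ 0 := by
    rintro rfl
    have : (0 : FractionalIdeal D⁰ K).tClosure = 0 :=
      le_antisymm ((tClosure_le_vClosure _).trans vClosure_zero.le) (zero_le _)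
    rw [zero_mul, this] at h
    exact zero_ne_one h
  have hJ : J ≤ I⁻¹ := fun y hy => (mem_inv_iff hI).2 fun x hx => by
    rw [← h, mul_comm y x]
    exact le_tClosure _ (mul_mem_mul hx hy)
  refine le_antisymm ?_ ?_
  · rw [← tClosure_one]
    exact tClosure_mono mul_one_div_le_one
  · rw [← h]
    exact tClosure_mono (mul_le_mul_right hJ I)

theorem isTInvertible_spanSingleton {x : K} (hx : x ≠ 0) :
    (spanSingleton D⁰ x).IsTInvertible := by
  rw [IsTInvertible, spanSingleton_mul_inv K hx, tClosure_one]

namespace TInv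

instance : Mul (TInv D K) := ⟨fun I J => ⟨(I.val * J.val).tClosure, tClosure_tClosure _, by
  refine isTInvertible_of_mul (J := I.val⁻¹ * J.val⁻¹) ?_
  rw [mul_comm, tClosure_mul_tClosure,
    show I.val⁻¹ * J.val⁻¹ * (I.val * J.val) = (I.val * I.val⁻¹) * (J.val * J.val⁻¹) by ring,
    ← tClosure_mul_tClosure, J.isTInvertible, mul_one, I.isTInvertible]⟩⟩

instance : One (TInv D K) := ⟨⟨1, tClosure_one, by
  simpa using isTInvertible_spanSingleton (D := D) (one_ne_zero (α := K))⟩⟩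

instance : Inv (TInv D K) := ⟨fun I => ⟨I.val⁻¹, tClosure_inv _,
  isTInvertible_of_mul (J := I.val) (by rw [mul_comm]; exact I.isTInvertible)⟩⟩

theorem mul_val (I J : TInv D K) : (I * J).val = (I.val * J.val).tClosure := rfl

theorem one_val : (1 : TInv D K).val = 1 := rfl

/-- `t-inv(D)` is an abelian group under the `t`-multiplication `(I, J) ↦ (I J)_t`, with the
identity `D` and the inverse `I⁻¹` of `I`. -/
instance : CommGroup (TInv D K) :=
  { Group.ofLeftAxioms
      (fun I J L => TInv.ext (by
        rw [mul_val, mul_val, mul_val, mul_val, tClosure_mul_tClosure, mul_comm _ L.val,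
          tClosure_mul_tClosure, mul_comm L.val, mul_assoc]))
      (fun I => TInv.ext (by rw [mul_val, one_val, one_mul]; exact I.isTIdeal))
      (fun I => TInv.ext (by
        rw [mul_val, mul_comm]; exact I.isTInvertible)) with
    mul_comm := fun I J => TInv.ext (by rw [mul_val, mul_val, mul_comm]) }

variable (D K) in
/-- The subgroup `P(D)` of `t-inv(D)` consisting of the nonzero principal fractional ideals. -/
def principal : Subgroup (TInv D K) where
  carrier := {I | ∃ x : K, x ≠ 0 ∧ I.val = spanSingleton D⁰ x}
  mul_mem' := by
    rintro I J ⟨x, hx, hI⟩ ⟨y, hy, hJ⟩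
    refine ⟨x * y, mul_ne_zero hx hy, ?_⟩
    rw [mul_val, hI, hJ, spanSingleton_mul_spanSingleton, tClosure_spanSingleton]
  one_mem' := ⟨1, one_ne_zero, by rw [one_val, spanSingleton_one]⟩
  inv_mem' := by
    rintro I ⟨x, hx, hI⟩
    refine ⟨x⁻¹, inv_ne_zero hx, ?_⟩
    change I.val⁻¹ = _
    rw [hI, spanSingleton_inv]

end TInv

end FractionalIdeal

open FractionalIdeal

variable (D K : Type*) [CommRing D] [IsDomain D] [Field K] [Algebra D K] [IsFractionRing D K]

/-- The `t`-class group `Cl_t(D) = t-inv(D) / P(D)`. -/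
abbrev TClassGroup : Type _ := TInv D K ⧸ TInv.principal D K

/-- `D` is an almost GCD domain: for all nonzero `a, b` there is `n ≥ 1` such that
`(aⁿ) ∩ (bⁿ)` is principal. -/
def IsAGCDDomain (D : Type*) [CommRing D] : Prop :=
  ∀ a b : D, a ≠ 0 → b ≠ 0 → ∃ n : ℕ, 1 ≤ n ∧
    (Ideal.span {a ^ n} ⊓ Ideal.span {b ^ n} : Ideal D).IsPrincipal

/-- A packet: an (integral) `t`-invertible `t`-ideal whose radical is prime. -/
def IsPacket (I : Ideal D) : Prop :=
  (I : FractionalIdeal D⁰ K).IsTIdeal ∧ (I : FractionalIdeal D⁰ K).IsTInvertible ∧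
    I.radical.IsPrime

/-- `I` and `J` are `t`-comaximal: `(I + J)_t = D`. -/
def IsTComaximal (I J : Ideal D) : Prop :=
  (((I ⊔ J : Ideal D) : FractionalIdeal D⁰ K)).tClosure = 1

/-- `D` is a unique representation domain: every proper (integral) `t`-invertible `t`-ideal is, in
a unique way up to order, the `t`-product of finitely many pairwise `t`-comaximal packets.  A packet
is proper, so it is not `t`-comaximal with itself; hence the factors are distinct and they form a
finite set. -/
def IsURD : Prop :=
  ∀ I : Ideal D, I ≠ ⊤ →
    (I : FractionalIdeal D⁰ K).IsTIdeal → (I : FractionalIdeal D⁰ K).IsTInvertible →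
    ∃! s : Finset (Ideal D), (∀ J ∈ s, IsPacket D K J) ∧
      (s : Set (Ideal D)).Pairwise (IsTComaximal D K) ∧
      (((∏ J ∈ s, J : Ideal D) : FractionalIdeal D⁰ K)).tClosure = (I : FractionalIdeal D⁰ K)

/-- `D` is Archimedean: `⋂ₙ (xⁿ) = 0` for every nonunit `x`. -/
def IsArchimedeanDomain (D : Type*) [CommRing D] : Prop :=
  ∀ x : D, ¬ IsUnit x → (⨅ n : ℕ, ⨅ _ : 1 ≤ n, Ideal.span {x ^ n}) = ⊥

variable {K} in
/-- A valuation domain with quotient field `K` has rank one: its Krull dimension is one. -/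
def ValuationSubring.IsRankOne (V : ValuationSubring K) : Prop := ringKrullDim V = 1

/-- `D` is the intersection, inside `K`, of the valuation domains in `𝓥` (the empty intersection
is `K`). -/
def IsIntersectionOf (𝓥 : Set (ValuationSubring K)) : Prop :=
  (⨅ V ∈ 𝓥, V.toSubring) = (algebraMap D K).range

/-- `𝓥` is locally finite: every nonzero element of `D` is a nonunit in only finitely many members
of `𝓥`. -/
def IsLocallyFiniteFamily (𝓥 : Set (ValuationSubring K)) : Prop :=
  ∀ x : D, x ≠ 0 → {V ∈ 𝓥 | V.valuation (algebraMap D K x) ≠ 1}.Finite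

variable {K} in
/-- `V` is essential for `D`: `V = D_P` for some prime ideal `P` of `D`. -/
def ValuationSubring.IsEssential (V : ValuationSubring K) : Prop :=
  ∃ P : Ideal D, P.IsPrime ∧
    (V : Set K) = {x : K | ∃ a s : D, s ∉ P ∧ x = algebraMap D K a / algebraMap D K s}

/-- `D` is a generalized Krull domain: a locally finite intersection of essential rank-one
valuation domains. -/
def IsGeneralizedKrullDomain : Prop :=
  ∃ 𝓥 : Set (ValuationSubring K), (∀ V ∈ 𝓥, V.IsRankOne ∧ V.IsEssential D) ∧
    IsIntersectionOf D K 𝓥 ∧ IsLocallyFiniteFamily D K 𝓥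

/-- `D` is an almost GUFD: a generalized Krull domain with torsion `t`-class group. -/
def IsAlmostGUFD : Prop :=
  IsGeneralizedKrullDomain D K ∧ IsMulTorsion (TClassGroup D K)

end

open scoped nonZeroDivisors

noncomputable section

open FractionalIdeal

/-! The statements are linked in one cycle. Rank-one valuation domains are completely integrally
closed, and this property passes to intersections. If `D` is completely integrally closed, a power
series over `K` that is almost integral over `D⟦X⟧` has all its coefficients in `D`, so `D⟦X⟧` is
integrally closed. If `D⟦X⟧` is integrally closed, so is `D`; and a nonunit `x` whose powers all
divide some `b ≠ 0` would make a Catalan-type root of `T² + xT + X` integral over `D⟦X⟧` with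
denominator `b`, forcing `x` to be a unit.

The rest is driven by almost GCDs. Suitable powers of two elements have a gcd with coprime
cofactors, and integral closedness lets one extract roots again. Hence every `t`-invertible
`t`-ideal has a power with principal `t`-closure: the `t`-class group is torsion, and each packet
has the radical of a principal ideal `(x)`. In the Archimedean case a nonzero prime strictly below
that radical would contain a nonzero element divisible by every power of `x`, so packets have
height-one radicals (`IsPacket.height_radical_of_isArchimedeanDomain`). Coprime elements cannot
share a height-one prime (`notMem_of_height_eq_one`); this makes `D_P` a valuation domain for `P` of
height one and `D` the intersection of these, while factorization into packets gives local
finiteness. -/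

/-! ### Rank-one valuation domains and complete integral closedness -/

/-- In a rank-one valuation domain, an element of the quotient field with a common denominator
for all its powers is integral. -/
theorem ValuationSubring.IsRankOne.mem_of_forall_mul_pow_mem {K : Type*} [Field K]
    {V : ValuationSubring K} (hV : V.IsRankOne) {x r : K} (hr : r ≠ 0)
    (h : ∀ n : ℕ, r * x ^ n ∈ V) : x ∈ V := by
  by_contra hx
  have hx0 : x ≠ 0 := fun h0 => hx (h0 ▸ V.zero_mem)
  have hy : x⁻¹ ∈ V := (V.mem_or_inv_mem x).resolve_left hx
  have hrV : r ∈ V := by simpa using h 0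
  have : Ring.KrullDimLE 1 V := Ring.krullDimLE_iff.2 hV.le
  -- In dimension one a prime containing `r ≠ 0` is maximal, so it contains the nonunit `x⁻¹`. Thus
  -- `x⁻¹ ^ n = r v` for some `n`, which gives `x = (r x ^ (n + 1)) v ∈ V`.
  have hrad : (⟨x⁻¹, hy⟩ : V) ∈ (Ideal.span {(⟨r, hrV⟩ : V)}).radical := by
    rw [Ideal.radical_eq_sInf, Ideal.mem_sInf]
    rintro P ⟨hP, hPp⟩
    have hP0 : P ≠ ⊥ := by
      rintro rfl
      have := hP (Ideal.mem_span_singleton_self _)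
      rw [Ideal.mem_bot] at this
      exact hr (congrArg Subtype.val this)
    have hPm : P.IsMaximal := Ring.krullDimLE_one_iff_of_noZeroDivisors.mp this _ hP0 hPp
    rw [IsLocalRing.eq_maximalIdeal hPm, IsLocalRing.mem_maximalIdeal, _root_.mem_nonunits_iff]
    rintro ⟨u, hu⟩
    refine hx ?_
    have h1 := congrArg Subtype.val u.mul_inv
    rw [hu] at h1
    have h2 : ((u⁻¹ : Vˣ) : V).1 = x := by
      have h3 : x⁻¹ * ((u⁻¹ : Vˣ) : V).1 = 1 := h1
      field_simp at h3
      exact h3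
    exact h2 ▸ ((u⁻¹ : Vˣ) : V).2
  obtain ⟨n, hn⟩ := hrad
  obtain ⟨v, hv⟩ := Ideal.mem_span_singleton.1 hn
  have hv' : x⁻¹ ^ n = r * v.1 := congrArg Subtype.val hv
  refine hx ?_
  have : x = r * x ^ (n + 1) * v.1 := by
    rw [mul_right_comm, ← hv', pow_succ, ← mul_assoc, ← mul_pow, inv_mul_cancel₀ hx0, one_pow,
      one_mul]
  rw [this]
  exact V.mul_mem _ _ (h _) v.2

section

variable {D K : Type*} [CommRing D] [IsDomain D] [Field K] [Algebra D K] [IsFractionRing D K]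

theorem completeIntegralClosure_eq_bot_of_isIntersectionOf {𝓥 : Set (ValuationSubring K)}
    (h1 : ∀ V ∈ 𝓥, V.IsRankOne) (hD : IsIntersectionOf D K 𝓥) :
    completeIntegralClosure D K = ⊥ := by
  have hle : ∀ V ∈ 𝓥, ∀ d : D, algebraMap D K d ∈ V := by
    intro V hV d
    have h2 : algebraMap D K d ∈ ⨅ V ∈ 𝓥, V.toSubring := hD ▸ ⟨d, rfl⟩
    exact Subring.mem_iInf.1 (Subring.mem_iInf.1 h2 V) hV
  refine eq_bot_iff.2 fun x hx => ?_
  obtain ⟨r, hr, hrx⟩ := hx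
  have h2 : x ∈ ⨅ V ∈ 𝓥, V.toSubring := by
    refine Subring.mem_iInf.2 fun V => Subring.mem_iInf.2 fun hV => ?_
    refine (h1 V hV).mem_of_forall_mul_pow_mem (r := algebraMap D K r) ?_ fun n => ?_
    · exact IsFractionRing.to_map_ne_zero_of_mem_nonZeroDivisors hr
    · obtain ⟨d, hd⟩ := hrx n
      rw [← Algebra.smul_def, ← hd]
      exact hle V hV d
  rw [hD] at h2
  obtain ⟨d, hd⟩ := h2
  exact Algebra.mem_bot.2 ⟨d, hd⟩

end

/-! ### Integral closedness of power series rings -/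

/-- If `A → B` is injective with `B` integrally closed and `a / b` is integral over `A`, then `b`
divides `a` in `B`. -/
theorem dvd_map_of_isIntegral_div {A B : Type*} [CommRing A] [IsDomain A] [CommRing B] [IsDomain B]
    [IsIntegrallyClosed B] (L : Type*) [Field L] [Algebra A L] [IsFractionRing A L] {f : A →+* B}
    (hf : Function.Injective f) {a b : A} (hb : b ≠ 0)
    (h : IsIntegral A (algebraMap A L a / algebraMap A L b)) : f b ∣ f a := by
  have hinj : Function.Injective ((algebraMap B (FractionRing B)).comp f) :=
    (IsFractionRing.injective B (FractionRing B)).comp hf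
  let g : L →+* FractionRing B := IsFractionRing.lift hinj
  have hg : ∀ c, g (algebraMap A L c) = algebraMap B _ (f c) := fun c =>
    IsFractionRing.lift_algebraMap hinj c
  have h1 : IsIntegral B (g (algebraMap A L a / algebraMap A L b)) :=
    h.map_of_comp_eq f g (RingHom.ext fun c => (hg c).symm)
  obtain ⟨c, hc⟩ := IsIntegrallyClosed.algebraMap_eq_of_integral h1
  refine ⟨c, IsFractionRing.injective B (FractionRing B) ?_⟩
  have hb' : algebraMap B (FractionRing B) (f b) ≠ 0 := fun h0 => hb (hf
    (IsFractionRing.injective B (FractionRing B) (by rw [h0, map_zero, map_zero])))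
  rw [map_mul, hc, map_div₀, hg, hg, mul_div_cancel₀ _ hb']

namespace PowerSeries

theorem mem_range_map_iff {A B : Type*} [CommRing A] [CommRing B] {f : A →+* B} {u : B⟦X⟧} :
    u ∈ (PowerSeries.map f).range ↔ ∀ i, coeff i u ∈ f.range := by
  constructor
  · rintro ⟨p, rfl⟩ i
    exact ⟨coeff i p, (coeff_map f i p).symm⟩
  · intro h
    choose c hc using h
    exact ⟨mk c, ext fun i => by rw [coeff_map, coeff_mk, hc]⟩

theorem mem_range_map_of_X_pow_mul {A B : Type*} [CommRing A] [CommRing B] {f : A →+* B}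
    {u : B⟦X⟧} {n : ℕ} (h : X ^ n * u ∈ (PowerSeries.map f).range) :
    u ∈ (PowerSeries.map f).range := by
  rw [mem_range_map_iff] at h ⊢
  intro i
  simpa [coeff_X_pow_mul] using h (i + n)

section AlmostIntegral

variable {D K : Type*} [CommRing D] [IsDomain D] [Field K] [Algebra D K]

/-- The lowest nonzero coefficient of `q` is a common denominator for all powers of the constant
term of `u`: cancel `X ^ q.order` and compare constant terms. -/
theorem constantCoeff_mem_range_of_forall_mul_pow_mem (h : completeIntegralClosure D K = ⊥)
    {q : D⟦X⟧} (hq : q ≠ 0) {u : K⟦X⟧}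
    (hu : ∀ n : ℕ, map (algebraMap D K) q * u ^ n ∈ (map (algebraMap D K)).range) :
    constantCoeff u ∈ (algebraMap D K).range := by
  suffices constantCoeff u ∈ completeIntegralClosure D K by
    rw [h] at this
    exact Algebra.mem_bot.1 this
  refine ⟨coeff q.order.toNat q, mem_nonZeroDivisors_of_ne_zero (coeff_order hq), fun n => ?_⟩
  have h1 : map (algebraMap D K) q.divXPowOrder * u ^ n ∈ (map (algebraMap D K)).range := by
    refine mem_range_map_of_X_pow_mul (n := q.order.toNat) ?_
    have := hu n
    rw [← X_pow_order_mul_divXPowOrder (f := q)] at this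
    rwa [map_mul, map_pow, map_X, mul_assoc] at this
  have h2 := mem_range_map_iff.1 h1 0
  rw [coeff_zero_eq_constantCoeff, map_mul, map_pow, ← coeff_zero_eq_constantCoeff, coeff_map,
    coeff_zero_eq_constantCoeff, constantCoeff_divXPowOrder] at h2
  rw [Algebra.smul_def]
  simpa using h2

/-- Coefficients of a power series almost integral over `D⟦X⟧` lie in `D`, if `D` is completely
integrally closed in `K`. -/
theorem coeff_mem_range_of_forall_mul_pow_mem (h : completeIntegralClosure D K = ⊥) {q : D⟦X⟧}
    (hq : q ≠ 0) {u : K⟦X⟧}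
    (hu : ∀ n : ℕ, map (algebraMap D K) q * u ^ n ∈ (map (algebraMap D K)).range) (i : ℕ) :
    coeff i u ∈ (algebraMap D K).range := by
  have h0 := constantCoeff_mem_range_of_forall_mul_pow_mem h hq hu
  induction i generalizing u with
  | zero => simpa using h0
  | succ i ih =>
    obtain ⟨d, hd⟩ := h0
    obtain ⟨v, hv⟩ : X ∣ u - C (constantCoeff u) := X_dvd_iff.2 (by simp)
    -- The shifted series `v = (u - u₀) / X` keeps the same denominator `q`: expand `(u - u₀) ^ n`
    -- binomially, using `u₀ ∈ D`.
    have hv' : ∀ n : ℕ, map (algebraMap D K) q * v ^ n ∈ (map (algebraMap D K)).range := by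
      intro n
      refine mem_range_map_of_X_pow_mul (n := n) ?_
      have h1 : X ^ n * (map (algebraMap D K) q * v ^ n) =
          map (algebraMap D K) q * (u + map (algebraMap D K) (C (-d))) ^ n := by
        rw [map_C, map_neg, hd, map_neg, ← sub_eq_add_neg, hv]
        ring
      rw [h1, add_pow, Finset.mul_sum]
      refine sum_mem fun m _ => ?_
      rw [← mul_assoc, ← mul_assoc]
      exact mul_mem (mul_mem (hu m) (pow_mem (RingHom.mem_range_self _ _) _)) (natCast_mem _ _)
    have h3 : coeff (i + 1) u = coeff i v := by
      have := congrArg (coeff (i + 1)) hv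
      simpa [coeff_C, coeff_succ_X_mul] using this
    rw [h3]
    exact ih hv' (constantCoeff_mem_range_of_forall_mul_pow_mem h hq hv')

end AlmostIntegral

variable {D K : Type*} [CommRing D] [IsDomain D] [Field K] [Algebra D K] [IsFractionRing D K]

/-- An integral fraction `f / g` is already a power series `u` over `K`, since `K⟦X⟧` is integrally
closed. Being integral it is almost integral, and the denominator `q` so obtained forces the
coefficients of `u` into `D`. -/
theorem isIntegrallyClosed_of_completeIntegralClosure_eq_bot
    (h : completeIntegralClosure D K = ⊥) : IsIntegrallyClosed D⟦X⟧ := by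
  rw [isIntegrallyClosed_iff (FractionRing D⟦X⟧)]
  intro x hx
  obtain ⟨q, hq, hqx⟩ := hx.isAlmostIntegral
  obtain ⟨f, g, hg, rfl⟩ := IsFractionRing.div_surjective D⟦X⟧ x
  have hinj : Function.Injective (map (algebraMap D K)) :=
    map_injective _ (IsFractionRing.injective D K)
  have hg0 := nonZeroDivisors.ne_zero hg
  obtain ⟨u, hu⟩ := dvd_map_of_isIntegral_div _ hinj hg0 hx
  have hgK : algebraMap D⟦X⟧ (FractionRing D⟦X⟧) g ≠ 0 :=
    IsFractionRing.to_map_ne_zero_of_mem_nonZeroDivisors hg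
  have hu1 : ∀ n : ℕ, map (algebraMap D K) q * u ^ n ∈ (map (algebraMap D K)).range := by
    intro n
    obtain ⟨p, hp⟩ := hqx n
    have h1 : q * f ^ n = p * g ^ n := by
      apply IsFractionRing.injective D⟦X⟧ (FractionRing D⟦X⟧)
      rw [map_mul, map_mul, map_pow, map_pow, hp, Algebra.smul_def, div_pow]
      field_simp
    refine ⟨p, ?_⟩
    have h2 := congrArg (map (algebraMap D K)) h1
    rw [map_mul, map_mul, map_pow, map_pow, hu] at h2
    have h3 : map (algebraMap D K) g ^ n ≠ 0 := pow_ne_zero _ fun h0 =>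
      hg0 (hinj (by rw [h0, map_zero]))
    apply mul_right_cancel₀ h3
    rw [← h2]
    ring
  obtain ⟨w, hw⟩ := mem_range_map_iff.2
    (coeff_mem_range_of_forall_mul_pow_mem h (nonZeroDivisors.ne_zero hq) hu1)
  refine ⟨w, ?_⟩
  have : f = g * w := hinj (by rw [map_mul, hu, hw])
  rw [this, map_mul, mul_div_cancel_left₀ _ hgK]

theorem isIntegrallyClosed_of_isIntegrallyClosed (D : Type*) [CommRing D] [IsDomain D]
    [IsIntegrallyClosed D⟦X⟧] : IsIntegrallyClosed D := by
  rw [isIntegrallyClosed_iff (FractionRing D)]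
  intro x hx
  obtain ⟨a, b, hb, rfl⟩ := IsFractionRing.div_surjective D x
  obtain ⟨v, hv⟩ := dvd_map_of_isIntegral_div _ (C_injective (R := D))
    (nonZeroDivisors.ne_zero hb) hx
  have h1 : a = b * constantCoeff v := by simpa using congrArg constantCoeff hv
  refine ⟨constantCoeff v, ?_⟩
  rw [h1, map_mul, mul_div_cancel_left₀]
  exact IsFractionRing.to_map_ne_zero_of_mem_nonZeroDivisors hb

/-- Over `K`, the polynomial `T² + xT + X` has the root `-(X / x) c(X / x²)`, with `c` the Catalan
series. If all powers of `x` divide `b ≠ 0`, then `b` times this root lies in `D⟦X⟧`. Integral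
closedness puts the root itself in `D⟦X⟧`, and its coefficient at `X` is `-1 / x`. -/
theorem isArchimedeanDomain_of_isIntegrallyClosed (D : Type*) [CommRing D] [IsDomain D]
    [IsIntegrallyClosed D⟦X⟧] : IsArchimedeanDomain D := by
  intro x hx
  rw [eq_bot_iff]
  intro b hb
  rw [Ideal.mem_bot]
  by_contra hb0
  simp only [Ideal.mem_iInf, Ideal.mem_span_singleton] at hb
  -- The coefficient of the root at `X ^ (n + 1)` has denominator `x ^ (2 * n + 1)`.
  have hb' : ∀ n, ∃ c, b = x ^ (2 * n + 1) * c := fun n => hb (2 * n + 1) (by omega)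
  choose β hβ using hb'
  have hx0 : x ≠ 0 := by
    rintro rfl
    exact hb0 (by simpa using hβ 0)
  let K := FractionRing D
  let ι := algebraMap D K
  have hι : Function.Injective ι := IsFractionRing.injective D K
  have hxK : ι x ≠ 0 := fun h0 => hx0 (hι (by rw [h0, map_zero]))
  let w : D⟦X⟧ := -(X * mk fun n => (catalan n : D) * β n)
  let c : K⟦X⟧ := rescale ((ι x)⁻¹ ^ 2) (map (Nat.castRingHom K) catalanSeries)
  have hc : c ^ 2 * (C ((ι x)⁻¹ ^ 2) * X) + 1 = c := by
    have := congrArg (fun p => rescale ((ι x)⁻¹ ^ 2) (map (Nat.castRingHom K) p))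
      catalanSeries_sq_mul_X_add_one
    simpa [c, rescale_X] using this
  have hw : map ι w = -(X * (C (ι b * (ι x)⁻¹) * c)) := by
    simp only [w, map_neg, map_mul, map_X]
    congr 2
    ext n
    rw [← map_mul C, coeff_C_mul, coeff_rescale, coeff_map, coeff_map, coeff_mk, catalanSeries_coeff, hβ n]
    simp only [map_mul, map_pow, map_natCast, eq_natCast]
    have h1 : ι x ^ (2 * n + 1) * (ι x)⁻¹ * ((ι x)⁻¹ ^ 2) ^ n = 1 := by
      rw [← pow_mul, mul_assoc, ← pow_succ', ← mul_pow, mul_inv_cancel₀ hxK, one_pow]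
    linear_combination (-((catalan n : K) * ι (β n))) * h1
  have hxC : (C (ι x) : K⟦X⟧) * C ((ι x)⁻¹) = 1 := by
    rw [← map_mul, mul_inv_cancel₀ hxK, map_one]
  have hquad : w ^ 2 + C x * C b * w + C b ^ 2 * X = 0 := by
    apply map_injective ι hι
    simp only [map_add, map_mul, map_pow, map_C, map_X, map_zero, hw]
    simp only [map_pow] at hc ⊢
    linear_combination (C (ι b) ^ 2 * X) * hc - (C (ι b) ^ 2 * X * c) * hxC
  have hbC : (C b : D⟦X⟧) ≠ 0 := fun h0 => hb0 (C_injective (by rw [h0, map_zero]))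
  have hint : IsIntegral D⟦X⟧ (algebraMap D⟦X⟧ (FractionRing D⟦X⟧) w /
      algebraMap D⟦X⟧ (FractionRing D⟦X⟧) (C b)) := by
    have hbL : algebraMap D⟦X⟧ (FractionRing D⟦X⟧) (C b) ≠ 0 :=
      IsFractionRing.to_map_ne_zero_of_mem_nonZeroDivisors (mem_nonZeroDivisors_of_ne_zero hbC)
    refine ⟨Polynomial.X ^ 2 + Polynomial.C (C x) * Polynomial.X + Polynomial.C X,
      by monicity!, ?_⟩
    simp only [Polynomial.eval₂_add, Polynomial.eval₂_mul, Polynomial.eval₂_pow,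
      Polynomial.eval₂_X, Polynomial.eval₂_C]
    have := congrArg (algebraMap D⟦X⟧ (FractionRing D⟦X⟧)) hquad
    simp only [map_add, map_mul, map_pow, map_zero] at this
    field_simp
    linear_combination this
  obtain ⟨v, hv⟩ := dvd_map_of_isIntegral_div (f := RingHom.id D⟦X⟧) _
    Function.injective_id hbC hint
  have h1 : coeff 1 w = b * coeff 1 v := by
    have := congrArg (coeff 1) hv
    simpa using this
  have h2 : coeff 1 w = - β 0 := by
    have : coeff (0 + 1) w = - β 0 := by simp [w, coeff_succ_X_mul]
    exact this
  -- From `b = x * β 0` and `-β 0 = b * coeff 1 v`, cancelling `b` shows that `-coeff 1 v` inverts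
  -- `x`.
  refine hx (IsUnit.of_mul_eq_one (-coeff 1 v) (mul_left_cancel₀ hb0 ?_))
  have h3 := hβ 0
  simp only [mul_zero, zero_add, pow_one] at h3
  linear_combination x * h1 - x * h2 - h3

end PowerSeries

/-! ### Powers of `t`-invertible `t`-ideals in almost GCD domains -/

namespace FractionalIdeal

theorem natCast_le_one {D K : Type*} [CommRing D] [Field K] [Algebra D K] (n : ℕ) : (n : FractionalIdeal D⁰ K) ≤ 1 := by
  induction n with
  | zero => simp
  | succ n ih => rw [Nat.cast_succ, ← sup_eq_add]; exact sup_le ih le_rfl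

variable {D K : Type*} [CommRing D] [IsDomain D] [Field K] [Algebra D K] [IsFractionRing D K]

theorem tClosure_pow_tClosure (I : FractionalIdeal D⁰ K) (n : ℕ) :
    (I.tClosure ^ n).tClosure = (I ^ n).tClosure := by
  induction n with
  | zero => simp
  | succ n ih =>
    rw [pow_succ, tClosure_mul_tClosure, mul_comm, ← tClosure_mul_tClosure, ih,
      tClosure_mul_tClosure, pow_succ']

theorem tClosure_add_tClosure (I J : FractionalIdeal D⁰ K) :
    (I.tClosure + J.tClosure).tClosure = (I + J).tClosure := by
  simp only [← sup_eq_add]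
  refine le_antisymm ?_ (tClosure_mono (sup_le_sup (le_tClosure I) (le_tClosure J)))
  rw [← tClosure_tClosure (I ⊔ J)]
  exact tClosure_mono (sup_le (tClosure_mono le_sup_left) (tClosure_mono le_sup_right))

theorem tClosure_le_spanSingleton {I : FractionalIdeal D⁰ K} {x : K}
    (h : I ≤ spanSingleton D⁰ x) : I.tClosure ≤ spanSingleton D⁰ x :=
  (tClosure_mono h).trans (tClosure_spanSingleton x).le

theorem tClosure_eq_vClosure {I : FractionalIdeal D⁰ K} (hI : (I : Submodule D K).FG) :
    I.tClosure = I.vClosure :=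
  le_antisymm (tClosure_le_vClosure I) fun _ hx => mem_tClosure.2 ⟨I, hI, le_rfl, hx⟩

theorem tClosure_pow_eq_spanSingleton {I : FractionalIdeal D⁰ K} {d : K}
    (h : I.tClosure = spanSingleton D⁰ d) (n : ℕ) :
    (I ^ n).tClosure = spanSingleton D⁰ (d ^ n) := by
  rw [← tClosure_pow_tClosure, h, spanSingleton_pow, tClosure_spanSingleton]

/-- For `α`, `β` in `D` with `(αⁿ) ∩ (βⁿ) = (l)`, the inverse of `(αⁿ, βⁿ)` is generated by `l / (αⁿ
βⁿ)`, so its `v`-closure, which equals the `t`-closure by finite generation, is principal. Fractions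
are reduced to this case by a common denominator. -/
theorem tClosure_span_pow_add_of_isAGCDDomain (h : IsAGCDDomain D) {a b : K} (ha : a ≠ 0)
    (hb : b ≠ 0) : ∃ n : ℕ, 1 ≤ n ∧ ∃ d : K, d ≠ 0 ∧
      (spanSingleton D⁰ (a ^ n) + spanSingleton D⁰ (b ^ n)).tClosure = spanSingleton D⁰ d := by
  have key : ∀ α β : D, α ≠ 0 → β ≠ 0 → ∃ n : ℕ, 1 ≤ n ∧ ∃ d : K, d ≠ 0 ∧
      (spanSingleton D⁰ (algebraMap D K α ^ n) +
        spanSingleton D⁰ (algebraMap D K β ^ n)).tClosure = spanSingleton D⁰ d := by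
    intro α β hα hβ
    obtain ⟨n, hn, ⟨l, hl⟩⟩ := h α β hα hβ
    have hmem : ∀ x, (α ^ n ∣ x ∧ β ^ n ∣ x) ↔ l ∣ x := by
      intro x
      rw [← Ideal.mem_span_singleton, ← Ideal.mem_span_singleton, ← Ideal.mem_span_singleton,
        ← Ideal.mem_inf, hl, Ideal.submodule_span_eq]
    have hαn : algebraMap D K α ^ n ≠ 0 := pow_ne_zero _ (by simpa using hα)
    have hβn : algebraMap D K β ^ n ≠ 0 := pow_ne_zero _ (by simpa using hβ)
    have hl0 : l ≠ 0 := by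
      rintro rfl
      exact mul_ne_zero (pow_ne_zero n hα) (pow_ne_zero n hβ)
        (zero_dvd_iff.1 ((hmem _).1 ⟨dvd_mul_right _ _, dvd_mul_left _ _⟩))
    have hlK : algebraMap D K l ≠ 0 := by simpa using hl0
    obtain ⟨⟨s, hs⟩, ⟨t, ht⟩⟩ := (hmem l).2 dvd_rfl
    have hsK := congrArg (algebraMap D K) hs
    have htK := congrArg (algebraMap D K) ht
    rw [map_mul, map_pow] at hsK htK
    refine ⟨n, hn, (algebraMap D K l / (algebraMap D K α ^ n * algebraMap D K β ^ n))⁻¹,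
      inv_ne_zero (div_ne_zero hlK (mul_ne_zero hαn hβn)), ?_⟩
    have hI : spanSingleton D⁰ (algebraMap D K α ^ n) + spanSingleton D⁰ (algebraMap D K β ^ n)
        ≠ 0 := by
      rw [← sup_eq_add]
      intro h0
      have h1 : spanSingleton D⁰ (algebraMap D K α ^ n) ≤ 0 := h0 ▸ le_sup_left
      exact hαn (spanSingleton_eq_zero_iff.1 (le_zero_iff.1 h1))
    rw [tClosure_eq_vClosure, vClosure, ← spanSingleton_inv]
    · congr 1
      ext z
      rw [mem_inv_iff hI, mem_spanSingleton]
      constructor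
      · intro hz
        obtain ⟨p, hp⟩ := (mem_one_iff D⁰).1 (hz (algebraMap D K α ^ n)
          ((mem_add _ _ _).2 ⟨_, mem_spanSingleton_self _ _, 0, zero_mem _, add_zero _⟩))
        obtain ⟨q, hq⟩ := (mem_one_iff D⁰).1 (hz (algebraMap D K β ^ n)
          ((mem_add _ _ _).2 ⟨0, zero_mem _, _, mem_spanSingleton_self _ _, zero_add _⟩))
        have hpq : p * β ^ n = q * α ^ n := by
          apply IsFractionRing.injective D K
          rw [map_mul, map_mul, map_pow, map_pow, hp, hq]
          ring
        obtain ⟨m, hm⟩ := (hmem (p * β ^ n)).1 ⟨hpq ▸ dvd_mul_left _ _, dvd_mul_left _ _⟩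
        refine ⟨m, ?_⟩
        have hmK := congrArg (algebraMap D K) hm
        rw [map_mul, map_mul, map_pow, hp] at hmK
        rw [Algebra.smul_def, mul_div_assoc', div_eq_iff (mul_ne_zero hαn hβn)]
        linear_combination -hmK
      · rintro ⟨m, rfl⟩
        intro y hy
        obtain ⟨i, hi, j, hj, rfl⟩ := (mem_add _ _ _).1 hy
        obtain ⟨c, rfl⟩ := (mem_spanSingleton D⁰).1 hi
        obtain ⟨e, rfl⟩ := (mem_spanSingleton D⁰).1 hj
        refine (mem_one_iff D⁰).2 ⟨m * (c * t + e * s), ?_⟩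
        simp only [Algebra.smul_def, map_mul, map_add]
        have h1 : algebraMap D K l / (algebraMap D K α ^ n * algebraMap D K β ^ n) *
            algebraMap D K α ^ n = algebraMap D K t := by
          rw [htK]; field_simp
        have h2 : algebraMap D K l / (algebraMap D K α ^ n * algebraMap D K β ^ n) *
            algebraMap D K β ^ n = algebraMap D K s := by
          rw [hsK]; field_simp
        rw [← h1, ← h2]
        ring
    · rw [coe_add, coe_spanSingleton, coe_spanSingleton]
      exact (Submodule.fg_span_singleton _).sup (Submodule.fg_span_singleton _)
  obtain ⟨a₁, a₂, ha₂, rfl⟩ := IsFractionRing.div_surjective D a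
  obtain ⟨b₁, b₂, hb₂, rfl⟩ := IsFractionRing.div_surjective D b
  have ha₂K : algebraMap D K a₂ ≠ 0 := IsFractionRing.to_map_ne_zero_of_mem_nonZeroDivisors ha₂
  have hb₂K : algebraMap D K b₂ ≠ 0 := IsFractionRing.to_map_ne_zero_of_mem_nonZeroDivisors hb₂
  have ha₁ : a₁ ≠ 0 := by rintro rfl; simp at ha
  have hb₁ : b₁ ≠ 0 := by rintro rfl; simp at hb
  obtain ⟨n, hn, d, hd, hdt⟩ := key (a₁ * b₂) (b₁ * a₂)
    (mul_ne_zero ha₁ (nonZeroDivisors.ne_zero hb₂)) (mul_ne_zero hb₁ (nonZeroDivisors.ne_zero ha₂))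
  have hc : (algebraMap D K a₂ * algebraMap D K b₂) ^ n ≠ 0 :=
    pow_ne_zero _ (mul_ne_zero ha₂K hb₂K)
  refine ⟨n, hn, ((algebraMap D K a₂ * algebraMap D K b₂) ^ n)⁻¹ * d,
    mul_ne_zero (inv_ne_zero hc) hd, ?_⟩
  have h1 : spanSingleton D⁰ ((algebraMap D K a₁ / algebraMap D K a₂) ^ n) +
      spanSingleton D⁰ ((algebraMap D K b₁ / algebraMap D K b₂) ^ n) =
      spanSingleton D⁰ ((algebraMap D K a₂ * algebraMap D K b₂) ^ n)⁻¹ *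
        (spanSingleton D⁰ (algebraMap D K (a₁ * b₂) ^ n) +
          spanSingleton D⁰ (algebraMap D K (b₁ * a₂) ^ n)) := by
    rw [mul_add, spanSingleton_mul_spanSingleton, spanSingleton_mul_spanSingleton]
    congr 2
    · rw [← inv_pow, ← mul_pow, map_mul]
      congr 1
      field_simp
    · rw [← inv_pow, ← mul_pow, map_mul]
      congr 1
      field_simp
  rw [h1, ← tClosure_mul_tClosure, hdt, spanSingleton_mul_spanSingleton, tClosure_spanSingleton]

/-- An element `x` of a binomial term `J ^ i * L ^ (N - i)` satisfies `x ^ N ∈ (f ^ N)`, so `x / f`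
has its `N`-th power in `D` and lies in `D` by integral closedness. -/
theorem add_pow_le_spanSingleton [IsIntegrallyClosed D] {J L : FractionalIdeal D⁰ K} {N : ℕ}
    (hN : 1 ≤ N) {f : K} (hf : f ≠ 0) (hJ : J ^ N ≤ spanSingleton D⁰ f)
    (hL : L ^ N ≤ spanSingleton D⁰ f) : (J + L) ^ N ≤ spanSingleton D⁰ f := by
  rw [add_pow]
  refine Finset.sum_induction _ (· ≤ spanSingleton D⁰ f)
    (fun a b ha hb => by rw [← sup_eq_add]; exact sup_le ha hb) (zero_le _) fun i hi => ?_
  have hi' : i ≤ N := Nat.lt_succ_iff.1 (Finset.mem_range.1 hi)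
  refine (mul_le_of_le_one_right' (natCast_le_one _)).trans fun x hx => ?_
  have h1 : x ^ N ∈ (J ^ i * L ^ (N - i)) ^ N := by
    have : spanSingleton D⁰ x ^ N ≤ (J ^ i * L ^ (N - i)) ^ N :=
      pow_le_pow_left' (spanSingleton_le_iff_mem.2 hx) N
    rw [spanSingleton_pow] at this
    exact spanSingleton_le_iff_mem.1 this
  have h2 : (J ^ i * L ^ (N - i)) ^ N ≤ spanSingleton D⁰ (f ^ N) := by
    rw [mul_pow, ← pow_mul, ← pow_mul, mul_comm i, mul_comm (N - i), pow_mul, pow_mul]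
    calc (J ^ N) ^ i * (L ^ N) ^ (N - i)
        ≤ spanSingleton D⁰ f ^ i * spanSingleton D⁰ f ^ (N - i) :=
          mul_le_mul' (pow_le_pow_left' hJ _) (pow_le_pow_left' hL _)
      _ = spanSingleton D⁰ (f ^ N) := by
          rw [← pow_add, Nat.add_sub_cancel' hi', spanSingleton_pow]
  obtain ⟨c, hc⟩ := (mem_spanSingleton D⁰).1 (h2 h1)
  have h3 : (x / f) ^ N = algebraMap D K c := by
    rw [div_pow, ← hc, Algebra.smul_def, mul_div_cancel_right₀ _ (pow_ne_zero _ hf)]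
  obtain ⟨y, hy⟩ := IsIntegrallyClosed.exists_algebraMap_eq_of_isIntegral_pow (R := D)
    (x := x / f) hN (h3 ▸ isIntegral_algebraMap)
  refine (mem_spanSingleton D⁰).2 ⟨y, ?_⟩
  rw [Algebra.smul_def, hy, div_mul_cancel₀ _ hf]

/-- Induction on generators. For a large common exponent `N`, both `J ^ N` and `L ^ N` have
principal closure, and so does `J ^ N + L ^ N`, say `(f)`. Then `(J + L) ^ N` is squeezed between
that sum and `(f)`. -/
theorem exists_tClosure_pow_eq_spanSingleton_of_fg [IsIntegrallyClosed D] (h : IsAGCDDomain D)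
    {J : FractionalIdeal D⁰ K} (hJ : (J : Submodule D K).FG) (hJ0 : J ≠ 0) :
    ∃ n : ℕ, 1 ≤ n ∧ ∃ d : K, d ≠ 0 ∧ (J ^ n).tClosure = spanSingleton D⁰ d := by
  suffices ∀ N : Submodule D K, N.FG → ∀ J : FractionalIdeal D⁰ K, (J : Submodule D K) = N →
      J ≠ 0 → ∃ n : ℕ, 1 ≤ n ∧ ∃ d : K, d ≠ 0 ∧ (J ^ n).tClosure = spanSingleton D⁰ d from
    this _ hJ J rfl hJ0
  intro N hN
  induction N, hN using Submodule.fg_induction with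
  | singleton x =>
    intro J hJ hJ0
    have h1 : J = spanSingleton D⁰ x := coeToSubmodule_injective <| by
      change (J : Submodule D K) = (spanSingleton D⁰ x : FractionalIdeal D⁰ K)
      rw [hJ, coe_spanSingleton]
    refine ⟨1, le_rfl, x, ?_, by rw [pow_one, h1, tClosure_spanSingleton]⟩
    rintro rfl
    exact hJ0 (by rw [h1, spanSingleton_zero])
  | sup N₁ N₂ hN₁ hN₂ ih₁ ih₂ =>
    intro M hM hM0
    let J : FractionalIdeal D⁰ K := ⟨N₁, isFractional_of_fg hN₁⟩
    let L : FractionalIdeal D⁰ K := ⟨N₂, isFractional_of_fg hN₂⟩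
    have hMJL : M = J + L := coeToSubmodule_injective <| by
      change (M : Submodule D K) = (J + L : FractionalIdeal D⁰ K)
      rw [hM, coe_add]
      rfl
    by_cases hJ : J = 0
    · rw [hJ, zero_add] at hMJL
      exact ih₂ M (by rw [hMJL]; rfl) hM0
    by_cases hL : L = 0
    · rw [hL, add_zero] at hMJL
      exact ih₁ M (by rw [hMJL]; rfl) hM0
    obtain ⟨n, hn, d, hd, hdt⟩ := ih₁ J rfl hJ
    obtain ⟨m, hm, e, he, het⟩ := ih₂ L rfl hL
    -- The generators `d ^ m` and `e ^ n` belong to the common exponent `n * m`; the almost GCD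
    -- property supplies a further factor `k`.
    obtain ⟨k, hk, f, hf, hft⟩ := tClosure_span_pow_add_of_isAGCDDomain h (pow_ne_zero m hd)
      (pow_ne_zero n he)
    have hJN : (J ^ (n * m * k)).tClosure = spanSingleton D⁰ ((d ^ m) ^ k) := by
      rw [mul_assoc, pow_mul, tClosure_pow_eq_spanSingleton hdt, pow_mul]
    have hLN : (L ^ (n * m * k)).tClosure = spanSingleton D⁰ ((e ^ n) ^ k) := by
      rw [mul_comm n m, mul_assoc, pow_mul, tClosure_pow_eq_spanSingleton het, pow_mul]
    rw [← hJN, ← hLN] at hft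
    have hN : 1 ≤ n * m * k := Nat.mul_pos (Nat.mul_pos hn hm) hk
    refine ⟨n * m * k, hN, f, hf, ?_⟩
    rw [hMJL]
    refine le_antisymm (tClosure_le_spanSingleton (add_pow_le_spanSingleton hN hf ?_ ?_)) ?_
    · rw [← hft, ← sup_eq_add]
      exact (le_tClosure _).trans (le_sup_left.trans (le_tClosure _))
    · rw [← hft, ← sup_eq_add]
      exact (le_tClosure _).trans (le_sup_right.trans (le_tClosure _))
    · rw [← hft, tClosure_add_tClosure]
      refine tClosure_mono ?_
      rw [← sup_eq_add, ← sup_eq_add]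
      exact sup_le (pow_le_pow_left' le_sup_left _) (pow_le_pow_left' le_sup_right _)

theorem _root_.Submodule.exists_fg_le_mul {R A : Type*} [CommSemiring R] [Semiring A] [Algebra R A]
    {P Q F : Submodule R A} (hF : F.FG) (h : F ≤ P * Q) :
    ∃ S : Submodule R A, S.FG ∧ S ≤ P ∧ F ≤ S * Q := by
  induction F, hF using Submodule.fg_induction with
  | singleton x =>
    obtain ⟨T, T', hT, hT', hx⟩ := Submodule.mem_span_mul_finite_of_mem_mul
      (h (Submodule.mem_span_singleton_self x))
    refine ⟨Submodule.span R T, ⟨T, rfl⟩, Submodule.span_le.2 hT, ?_⟩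
    rw [Submodule.span_singleton_le_iff_mem]
    rw [← Submodule.span_mul_span] at hx
    exact mul_le_mul' le_rfl (Submodule.span_le.2 hT') hx
  | sup F₁ F₂ _ _ ih₁ ih₂ =>
    obtain ⟨S₁, h1, h1P, h1F⟩ := ih₁ (le_sup_left.trans h)
    obtain ⟨S₂, h2, h2P, h2F⟩ := ih₂ (le_sup_right.trans h)
    exact ⟨S₁ ⊔ S₂, h1.sup h2, sup_le h1P h2P, sup_le
      (h1F.trans (mul_le_mul' le_sup_left le_rfl))
      (h2F.trans (mul_le_mul' le_sup_right le_rfl))⟩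

/-- That `1` lies in `(I I⁻¹)_t` is witnessed by a finitely generated `F ⊆ J I⁻¹` with `J ⊆ I`
finitely generated. For `y ∈ I` this gives `yF ⊆ J (I I⁻¹) ⊆ J`, hence `y ∈ J_v`. -/
theorem exists_fg_tClosure_eq {I : FractionalIdeal D⁰ K} (h1 : I.IsTIdeal)
    (h2 : I.IsTInvertible) :
    ∃ J : FractionalIdeal D⁰ K, (J : Submodule D K).FG ∧ J ≠ 0 ∧ J.tClosure = I := by
  have hone : (1 : K) ∈ (I * I⁻¹).tClosure := by rw [h2]; exact one_mem_one D⁰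
  obtain ⟨F, hF, hFI, hF1⟩ := mem_tClosure.1 hone
  rw [← coe_le_coe, coe_mul] at hFI
  obtain ⟨S, hS, hSI, hFS⟩ := Submodule.exists_fg_le_mul hF hFI
  let J : FractionalIdeal D⁰ K := ⟨S, isFractional_of_fg hS⟩
  have hFJ : F ≤ J * I⁻¹ := by rw [← coe_le_coe, coe_mul]; exact hFS
  have hJI : J ≤ I := hSI
  have hle : I ≤ J.tClosure := by
    intro y hy
    refine mem_tClosure.2 ⟨J, hS, le_rfl, ?_⟩
    have h3 := mul_mem_vClosure (mem_spanSingleton_self D⁰ y) hF1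
    rw [mul_one] at h3
    refine vClosure_mono ?_ h3
    calc spanSingleton D⁰ y * F ≤ I * (J * I⁻¹) :=
          mul_le_mul' (spanSingleton_le_iff_mem.2 hy) hFJ
      _ = J * (I * I⁻¹) := by ring
      _ ≤ J * 1 := mul_le_mul' le_rfl mul_one_div_le_one
      _ = J := mul_one J
  have hJt : J.tClosure = I := le_antisymm ((tClosure_mono hJI).trans h1.le) hle
  refine ⟨J, hS, ?_, hJt⟩
  intro h0
  refine h2.ne_zero (le_zero_iff.1 ?_)
  rw [← hJt, h0]
  exact (tClosure_le_vClosure _).trans vClosure_zero.le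

/-- In an integrally closed almost GCD domain, some power of every `t`-invertible `t`-ideal is
principal. -/
theorem exists_tClosure_pow_eq_spanSingleton [IsIntegrallyClosed D] (h : IsAGCDDomain D)
    {I : FractionalIdeal D⁰ K} (h1 : I.IsTIdeal) (h2 : I.IsTInvertible) :
    ∃ n : ℕ, 1 ≤ n ∧ ∃ d : K, d ≠ 0 ∧ (I ^ n).tClosure = spanSingleton D⁰ d := by
  obtain ⟨J, hJ, hJ0, rfl⟩ := exists_fg_tClosure_eq h1 h2
  obtain ⟨n, hn, d, hd, hdt⟩ := exists_tClosure_pow_eq_spanSingleton_of_fg h hJ hJ0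
  exact ⟨n, hn, d, hd, by rw [tClosure_pow_tClosure, hdt]⟩

theorem TInv.pow_val (I : TInv D K) (n : ℕ) : (I ^ n).val = (I.val ^ n).tClosure := by
  induction n with
  | zero => rw [pow_zero, pow_zero, one_val, tClosure_one]
  | succ n ih => rw [pow_succ', pow_succ', mul_val, ih, tClosure_mul_tClosure]

end FractionalIdeal

/-! ### Torsion of the `t`-class group and radicals of packets -/

section

variable {D K : Type*} [CommRing D] [IsDomain D] [Field K] [Algebra D K] [IsFractionRing D K]

theorem isMulTorsion_tClassGroup [IsIntegrallyClosed D] (h : IsAGCDDomain D) :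
    IsMulTorsion (TClassGroup D K) := by
  intro g
  obtain ⟨I, rfl⟩ := QuotientGroup.mk_surjective g
  obtain ⟨n, hn, d, hd, hdt⟩ := exists_tClosure_pow_eq_spanSingleton h I.isTIdeal I.isTInvertible
  rw [isOfFinOrder_iff_pow_eq_one]
  refine ⟨n, hn, ?_⟩
  rw [← QuotientGroup.mk_pow, QuotientGroup.eq_one_iff]
  exact ⟨d, hd, by rw [TInv.pow_val, hdt]⟩

/-- In an integrally closed almost GCD domain, every packet has the radical of a principal one. -/
theorem IsPacket.exists_radical_span_singleton_eq [IsIntegrallyClosed D] (h : IsAGCDDomain D)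
    {I : Ideal D} (hI : IsPacket D K I) :
    ∃ x : D, x ≠ 0 ∧ (Ideal.span {x}).radical = I.radical := by
  obtain ⟨hI1, hI2, -⟩ := hI
  obtain ⟨n, hn, d, hd, hdt⟩ := exists_tClosure_pow_eq_spanSingleton h hI1 hI2
  -- The generator lies in `I` because `I ^ n ⊆ I = I_t`; then `Iⁿ ⊆ (d) ⊆ I` makes the radicals
  -- equal.
  have hdI : d ∈ (I : FractionalIdeal D⁰ K) := by
    have h1 : ((I : FractionalIdeal D⁰ K) ^ n).tClosure ≤ I := by
      refine (tClosure_mono ?_).trans hI1.le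
      rw [← coeIdeal_pow, coeIdeal_le_coeIdeal]
      exact Ideal.pow_le_self (by omega)
    exact h1 (hdt ▸ mem_spanSingleton_self D⁰ d)
  obtain ⟨x, hx, rfl⟩ := (mem_coeIdeal D⁰).1 hdI
  refine ⟨x, fun h0 => hd (by rw [h0, map_zero]), le_antisymm (Ideal.radical_mono ?_) ?_⟩
  · exact (Ideal.span_singleton_le_iff_mem I).2 hx
  · rw [Ideal.radical_le_radical_iff]
    intro y hy
    refine ⟨n, ?_⟩
    have h2 : ((I ^ n : Ideal D) : FractionalIdeal D⁰ K) ≤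
        ((Ideal.span {x} : Ideal D) : FractionalIdeal D⁰ K) := by
      rw [coeIdeal_pow, coeIdeal_span_singleton, ← hdt]
      exact le_tClosure _
    exact (coeIdeal_le_coeIdeal K).1 h2 (Ideal.pow_mem_pow hy n)

theorem IsURD.exists_packets (h : IsURD D K) {x : D} (hx0 : x ≠ 0) (hx : ¬ IsUnit x) :
    ∃ s : Finset (Ideal D), s.Nonempty ∧ (∀ J ∈ s, IsPacket D K J ∧ x ∈ J) ∧
      ∏ J ∈ s, J ≤ Ideal.span {x} := by
  obtain ⟨s, ⟨hs, -, hprod⟩, -⟩ := h (Ideal.span {x})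
    (by rwa [Ne, Ideal.span_singleton_eq_top])
    (by rw [coeIdeal_span_singleton]; exact tClosure_spanSingleton _)
    (by rw [coeIdeal_span_singleton]; exact isTInvertible_spanSingleton (by simpa using hx0))
  refine ⟨s, ?_, fun J hJ => ⟨hs J hJ, ?_⟩, ?_⟩
  · rw [Finset.nonempty_iff_ne_empty]
    rintro rfl
    rw [Finset.prod_empty, Ideal.one_eq_top, coeIdeal_top, tClosure_one, ← coeIdeal_top,
      coeIdeal_inj, eq_comm, Ideal.span_singleton_eq_top] at hprod
    exact hx hprod
  · have h1 : ((Ideal.span {x} : Ideal D) : FractionalIdeal D⁰ K) ≤ J := by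
      rw [← hprod]
      refine (tClosure_mono ?_).trans (hs J hJ).1.le
      rw [coeIdeal_le_coeIdeal]
      exact Ideal.prod_le_inf.trans (Finset.inf_le hJ)
    exact (coeIdeal_le_coeIdeal K).1 h1 (Ideal.mem_span_singleton_self x)
  · rw [← coeIdeal_le_coeIdeal K, ← hprod]
    exact le_tClosure _

end

/-! ### Coprime cofactors and height-one primes -/

section Coprime

variable {D : Type*} [CommRing D] [IsDomain D]

/-- In an almost GCD domain, suitable powers of `a` and `b` have a greatest common divisor `d`, in
the strong sense that the cofactors `a'`, `b'` satisfy `(a') : (b') = (a')`. -/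
theorem IsAGCDDomain.exists_pow_eq_mul (h : IsAGCDDomain D) {a b : D} (ha : a ≠ 0) (hb : b ≠ 0) :
    ∃ n : ℕ, 1 ≤ n ∧ ∃ d a' b' : D, a ^ n = d * a' ∧ b ^ n = d * b' ∧
      ∀ c, a' ∣ b' * c → a' ∣ c := by
  obtain ⟨n, hn, ⟨l, hl⟩⟩ := h a b ha hb
  have hmem : ∀ x, (a ^ n ∣ x ∧ b ^ n ∣ x) ↔ l ∣ x := by
    intro x
    rw [← Ideal.mem_span_singleton, ← Ideal.mem_span_singleton, ← Ideal.mem_span_singleton,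
      ← Ideal.mem_inf, hl, Ideal.submodule_span_eq]
  have ha' := pow_ne_zero n ha
  have hb' := pow_ne_zero n hb
  obtain ⟨⟨s, hs⟩, ⟨t, ht⟩⟩ := (hmem l).2 dvd_rfl
  obtain ⟨d, hd⟩ := (hmem (a ^ n * b ^ n)).1 ⟨dvd_mul_right _ _, dvd_mul_left _ _⟩
  have hbd : b ^ n = d * s := mul_left_cancel₀ ha' (by rw [hd, hs]; ring)
  have had : a ^ n = d * t := mul_left_cancel₀ hb' (by rw [mul_comm, hd, ht]; ring)
  refine ⟨n, hn, d, t, s, had, hbd, fun c ⟨e, he⟩ => ?_⟩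
  -- Multiplying by `d` turns `t ∣ s * c` into `a ^ n ∣ b ^ n * c`, so `l = b ^ n * t` divides `b ^
  -- n * c`.
  obtain ⟨k, hk⟩ := (hmem (b ^ n * c)).1
    ⟨⟨e, by rw [hbd, had]; linear_combination d * he⟩, dvd_mul_right _ _⟩
  exact ⟨k, mul_left_cancel₀ hb' (by rw [hk, ht]; ring)⟩

/-- The condition `(a) : (b) = (a)` passes to powers of `b` and then of `a`. With `a ^ m = p u` and
`b ^ m = p v`, it follows from `a ^ m ∣ b ^ m * u` that `p u ∣ u`. -/
theorem isUnit_of_dvd_pow_of_dvd_pow {a b : D} (ha : a ≠ 0) (hab : ∀ c, a ∣ b * c → a ∣ c)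
    {p : D} {m : ℕ} (hpa : p ∣ a ^ m) (hpb : p ∣ b ^ m) : IsUnit p := by
  have h1 : ∀ (j : ℕ) c, a ∣ b ^ j * c → a ∣ c := by
    intro j
    induction j with
    | zero => intro c hc; simpa using hc
    | succ j ih => intro c hc; exact ih c (hab _ (by rwa [← mul_assoc, ← pow_succ']))
  have h2 : ∀ (i j : ℕ) c, a ^ i ∣ b ^ j * c → a ^ i ∣ c := by
    intro i j
    induction i with
    | zero => intro c _; simp
    | succ i ih =>
      intro c hc
      obtain ⟨c', rfl⟩ := h1 j c ((dvd_pow_self a i.succ_ne_zero).trans hc)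
      rw [pow_succ', mul_left_comm] at hc
      rw [pow_succ']
      exact mul_dvd_mul_left a (ih c' ((mul_dvd_mul_iff_left ha).1 hc))
  obtain ⟨u, hu⟩ := hpa
  obtain ⟨v, hv⟩ := hpb
  have hpu : p * u ≠ 0 := hu ▸ pow_ne_zero m ha
  obtain ⟨w, hw⟩ := h2 m m u ⟨v, by rw [hv, hu]; ring⟩
  refine IsUnit.of_mul_eq_one w (mul_left_cancel₀ (right_ne_zero_of_mul hpu) ?_)
  rw [hu] at hw
  linear_combination -hw

theorem Ideal.height_eq_one_of_forall_lt {P : Ideal D} [hP : P.IsPrime] (h0 : P ≠ ⊥)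
    (h : ∀ Q : Ideal D, Q.IsPrime → Q < P → Q = ⊥) : P.height = 1 := by
  refine le_antisymm ?_ ?_
  · have : P.height ≤ (1 : ℕ) := by
      rw [Ideal.height_le_iff]
      intro Q hQ hlt
      rw [h Q hQ hlt, Ideal.height_bot]
      simp
    simpa using this
  · rw [Order.one_le_iff_ne_zero]
    exact fun h1 => h0 (Ideal.height_eq_zero_iff_eq_bot.1 h1)

theorem Ideal.eq_of_le_of_height_eq_one {P Q : Ideal D} [Q.IsPrime] [hP : P.IsPrime] (h0 : Q ≠ ⊥)
    (hle : Q ≤ P) (h : P.height = 1) : Q = P := by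
  by_contra hne
  have h1 : P.height ≤ (1 : ℕ) := by simp [h]
  have h2 := Ideal.height_le_iff.1 h1 Q inferInstance (lt_of_le_of_ne hle hne)
  rw [Nat.cast_one, Order.lt_one_iff] at h2
  exact h0 (Ideal.height_eq_zero_iff_eq_bot.1 h2)

end Coprime

/-! ### Packets and height-one primes -/

section

variable {D K : Type*} [CommRing D] [IsDomain D] [Field K] [Algebra D K] [IsFractionRing D K]

theorem IsPacket.ne_bot {I : Ideal D} (hI : IsPacket D K I) : I ≠ ⊥ := fun h =>
  hI.2.1.ne_zero (by rw [h, coeIdeal_bot])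

theorem IsPacket.radical_ne_bot {I : Ideal D} (hI : IsPacket D K I) : I.radical ≠ ⊥ := fun h =>
  hI.ne_bot (le_bot_iff.1 (h ▸ Ideal.le_radical))

theorem IsURD.exists_packet_le (h : IsURD D K) {P : Ideal D} [hP : P.IsPrime] {x : D}
    (hx0 : x ≠ 0) (hx : x ∈ P) : ∃ I : Ideal D, IsPacket D K I ∧ x ∈ I ∧ I ≤ P := by
  obtain ⟨s, -, hs, hprod⟩ := h.exists_packets hx0
    fun hu => hP.ne_top (Ideal.eq_top_of_isUnit_mem P hx hu)
  obtain ⟨I, hI, hIP⟩ := (Ideal.IsPrime.prod_le hP).1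
    (hprod.trans ((Ideal.span_singleton_le_iff_mem P).2 hx))
  exact ⟨I, (hs I hI).1, (hs I hI).2, hIP⟩

/-- Let `Q` be a nonzero prime strictly below `I.radical = rad (x)`, and let `rad (y) ⊆ Q` come from
a packet inside `Q`. Then every `x ^ m` divides `y`: write `x ^ (m * n) = d a` and `y ^ n = d b`
with `a`, `b` coprime. Since `x ∉ Q`, also `d ∉ Q`, so `b ∈ Q ⊆ rad (x)`; hence `a`, a divisor of a
power of `x`, divides a power of `b` and is a unit. -/
theorem IsPacket.height_radical_of_isArchimedeanDomain [IsIntegrallyClosed D]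
    (hA : IsAGCDDomain D) (hU : IsURD D K) (hArch : IsArchimedeanDomain D) {I : Ideal D}
    (hI : IsPacket D K I) : I.radical.height = 1 := by
  have hP := hI.2.2
  refine Ideal.height_eq_one_of_forall_lt hI.radical_ne_bot fun Q hQ hQI => ?_
  obtain ⟨x, hx0, hx⟩ := hI.exists_radical_span_singleton_eq hA
  by_contra hQ0
  obtain ⟨y₀, hy₀, hy₀0⟩ := Submodule.exists_mem_ne_zero_of_ne_bot hQ0
  obtain ⟨I', hI', -, hI'Q⟩ := hU.exists_packet_le hy₀0 hy₀
  obtain ⟨y, hy0, hy⟩ := hI'.exists_radical_span_singleton_eq hA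
  have hxP : x ∈ I.radical := hx ▸ Ideal.le_radical (Ideal.mem_span_singleton_self x)
  have hxQ : x ∉ Q := fun h => hQI.not_ge
    (hx ▸ hQ.radical_le_iff.2 ((Ideal.span_singleton_le_iff_mem Q).2 h))
  have hyI' : y ∈ I'.radical := hy ▸ Ideal.le_radical (Ideal.mem_span_singleton_self y)
  have hI'Q' : I'.radical ≤ Q := hQ.radical_le_iff.2 hI'Q
  have hprime := hI'.2.2
  have hxu : ¬ IsUnit x := fun hu => hP.ne_top (Ideal.eq_top_of_isUnit_mem _ hxP hu)
  refine hy0 ?_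
  rw [← Ideal.mem_bot, ← hArch x hxu]
  simp only [Ideal.mem_iInf, Ideal.mem_span_singleton]
  intro m hm
  obtain ⟨n, hn, d, a, b, ha, hb, hab⟩ := hA.exists_pow_eq_mul (pow_ne_zero m hx0) hy0
  have ha0 : a ≠ 0 := by
    rintro rfl
    exact pow_ne_zero n (pow_ne_zero m hx0) (by rw [ha, mul_zero])
  have hdQ : d ∉ Q := by
    intro hd
    refine hxQ (hQ.mem_of_pow_mem m (hQ.mem_of_pow_mem n ?_))
    rw [ha]
    exact Q.mul_mem_right _ hd
  have hbI' : b ∈ I'.radical := by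
    refine (hprime.mem_or_mem (x := d) (y := b) ?_).resolve_left fun hd => hdQ (hI'Q' hd)
    rw [← hb]
    exact Ideal.pow_mem_of_mem _ hyI' n hn
  obtain ⟨r, hr⟩ : b ∈ (Ideal.span {x}).radical := hx ▸ hQI.le (hI'Q' hbI')
  rw [Ideal.mem_span_singleton] at hr
  have hunit : IsUnit a := by
    -- The `+ 1` keeps the exponent positive, so that `a` divides its own power even if `r = 0`.
    refine isUnit_of_dvd_pow_of_dvd_pow ha0 hab (m := r * (m * n) + 1)
      (dvd_pow_self a (Nat.succ_ne_zero _)) ?_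
    have h1 : a ∣ x ^ (m * n) := by rw [pow_mul, ha]; exact dvd_mul_left _ _
    refine (h1.trans (pow_dvd_pow_of_dvd hr (m * n))).trans ?_
    rw [← pow_mul]
    exact pow_dvd_pow _ (Nat.le_succ _)
  refine (IsIntegrallyClosed.pow_dvd_pow_iff (n := n) (by omega)).1 ?_
  rw [ha, hb]
  exact hunit.mul_right_dvd.2 (dvd_mul_right _ _)

/-- A packet inside `P` has radical `P = rad (x)`. If `a` and `b` were both in `P`, then `x` would
divide powers of both, hence be a unit. -/
theorem notMem_of_height_eq_one [IsIntegrallyClosed D] (hA : IsAGCDDomain D) (hU : IsURD D K)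
    {P : Ideal D} [hP : P.IsPrime] (hP1 : P.height = 1) {a b : D} (ha : a ≠ 0) (hab : ∀ c, a ∣ b * c → a ∣ c) (haP : a ∈ P) :
    b ∉ P := by
  intro hbP
  obtain ⟨I, hI, -, hIP⟩ := hU.exists_packet_le ha haP
  have hprime := hI.2.2
  have hrad : I.radical = P :=
    Ideal.eq_of_le_of_height_eq_one hI.radical_ne_bot (hP.radical_le_iff.2 hIP) hP1
  obtain ⟨x, hx0, hx⟩ := hI.exists_radical_span_singleton_eq hA
  obtain ⟨i, hi⟩ : a ∈ (Ideal.span {x}).radical := by rwa [hx, hrad]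
  obtain ⟨j, hj⟩ : b ∈ (Ideal.span {x}).radical := by rwa [hx, hrad]
  rw [Ideal.mem_span_singleton] at hi hj
  have hu := isUnit_of_dvd_pow_of_dvd_pow ha hab (hi.trans (pow_dvd_pow a (le_max_left i j)))
    (hj.trans (pow_dvd_pow b (le_max_right i j)))
  rw [← Ideal.span_singleton_eq_top] at hu
  rw [hu, Ideal.radical_top] at hx
  exact hprime.ne_top hx.symm

/-- Such a prime contains a packet from the factorization of `(x)`, and height one makes it the
radical of that packet. -/
theorem finite_setOf_height_eq_one_mem (hU : IsURD D K) {x : D} (hx : x ≠ 0) :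
    {P : Ideal D | P.IsPrime ∧ P.height = 1 ∧ x ∈ P}.Finite := by
  by_cases hu : IsUnit x
  · refine Set.finite_empty.subset ?_
    rintro P ⟨hP, _, hxP⟩
    exact hP.ne_top (Ideal.eq_top_of_isUnit_mem P hxP hu)
  obtain ⟨s, -, hs, hprod⟩ := hU.exists_packets hx hu
  refine (s.finite_toSet.image Ideal.radical).subset ?_
  rintro P ⟨hP, hP1, hxP⟩
  obtain ⟨I, hI, hIP⟩ := (Ideal.IsPrime.prod_le hP).1
    (hprod.trans ((Ideal.span_singleton_le_iff_mem P).2 hxP))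
  have hprime := (hs I hI).1.2.2
  exact ⟨I, hI, Ideal.eq_of_le_of_height_eq_one (hs I hI).1.radical_ne_bot
    (hP.radical_le_iff.2 hIP) hP1⟩

/-! ### Localizations at height-one primes as essential valuation domains -/

variable (K) in
/-- The subset `D_P` of the quotient field. -/
def localizationSet (P : Ideal D) : Set K :=
  {x : K | ∃ a s : D, s ∉ P ∧ x = algebraMap D K a / algebraMap D K s}

variable (K) in
/-- The localization `D_P` as a valuation subring, if for every `x` it contains `x` or `x⁻¹`. -/
def ValuationSubring.ofLocalization (P : Ideal D) [P.IsPrime]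
    (h : ∀ x : K, x ∈ localizationSet K P ∨ x⁻¹ ∈ localizationSet K P) : ValuationSubring K :=
  { (Localization.subalgebra.ofField K P.primeCompl P.primeCompl_le_nonZeroDivisors).toSubring with
    mem_or_inv_mem' := fun x => (h x).imp
      (fun ⟨a, s, hs, hx⟩ => ⟨a, s, hs, by rw [hx, div_eq_mul_inv]⟩)
      (fun ⟨a, s, hs, hx⟩ => ⟨a, s, hs, by rw [hx, div_eq_mul_inv]⟩) }

theorem ValuationSubring.coe_ofLocalization (P : Ideal D) [P.IsPrime]
    (h : ∀ x : K, x ∈ localizationSet K P ∨ x⁻¹ ∈ localizationSet K P) :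
    (ValuationSubring.ofLocalization K P h : Set K) = localizationSet K P := by
  ext x
  constructor
  · rintro ⟨a, s, hs, hx⟩
    exact ⟨a, s, hs, by rw [hx, div_eq_mul_inv]⟩
  · rintro ⟨a, s, hs, hx⟩
    exact ⟨a, s, hs, by rw [hx, div_eq_mul_inv]⟩

theorem ValuationSubring.ringKrullDim_ofLocalization (P : Ideal D) [P.IsPrime]
    (h : ∀ x : K, x ∈ localizationSet K P ∨ x⁻¹ ∈ localizationSet K P) :
    ringKrullDim (ValuationSubring.ofLocalization K P h) = P.height :=
  IsLocalization.AtPrime.ringKrullDim_eq_height P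
    (Localization.subalgebra.ofField K P.primeCompl P.primeCompl_le_nonZeroDivisors)

theorem mem_localizationSet_of_pow_mem [IsIntegrallyClosed D] {P : Ideal D} {x : K} {n : ℕ} (hn : 1 ≤ n) (h : x ^ n ∈ localizationSet K P) : x ∈ localizationSet K P := by
  obtain ⟨a, s, hs, hx⟩ := h
  have hs0 : algebraMap D K s ≠ 0 := by
    intro h0
    rw [(IsFractionRing.injective D K) (h0.trans (map_zero _).symm)] at hs
    exact hs P.zero_mem
  have h1 : (x * algebraMap D K s) ^ n = algebraMap D K (a * s ^ (n - 1)) := by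
    obtain ⟨k, rfl⟩ := Nat.exists_eq_add_of_le' hn
    rw [mul_pow, hx, map_mul, map_pow, Nat.add_sub_cancel, pow_succ']
    field_simp
  obtain ⟨y, hy⟩ := IsIntegrallyClosed.exists_algebraMap_eq_of_isIntegral_pow (R := D)
    (x := x * algebraMap D K s) hn (h1 ▸ isIntegral_algebraMap)
  exact ⟨y, s, hs, by rw [hy, mul_div_cancel_right₀ _ hs0]⟩

/-- Some power of `x` is a quotient of coprime cofactors, of which at most one lies in `P`; roots
are then extracted in `D_P`. -/
theorem mem_or_inv_mem_localizationSet [IsIntegrallyClosed D] (hA : IsAGCDDomain D)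
    (hU : IsURD D K) {P : Ideal D} [hP : P.IsPrime] (hP1 : P.height = 1) (x : K) :
    x ∈ localizationSet K P ∨ x⁻¹ ∈ localizationSet K P := by
  have h1P : (1 : D) ∉ P := (Ideal.ne_top_iff_one P).1 hP.ne_top
  by_cases hx : x = 0
  · exact Or.inl ⟨0, 1, h1P, by simp [hx]⟩
  obtain ⟨a, b, hb, rfl⟩ := IsFractionRing.div_surjective D x
  have hb0 := nonZeroDivisors.ne_zero hb
  have ha0 : a ≠ 0 := by rintro rfl; simp at hx
  obtain ⟨n, hn, d, a', b', ha, hb, hab⟩ := hA.exists_pow_eq_mul ha0 hb0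
  have hd0 : d ≠ 0 := by rintro rfl; exact pow_ne_zero n ha0 (by rw [ha, zero_mul])
  have ha'0 : a' ≠ 0 := by rintro rfl; exact pow_ne_zero n ha0 (by rw [ha, mul_zero])
  have hdK : algebraMap D K d ≠ 0 := by simpa using hd0
  have hpow : (algebraMap D K a / algebraMap D K b) ^ n = algebraMap D K a' / algebraMap D K b' := by
    rw [div_pow, ← map_pow, ← map_pow, ha, hb, map_mul, map_mul, mul_div_mul_left _ _ hdK]
  by_cases haP : a' ∈ P
  · have hbP := notMem_of_height_eq_one hA hU hP1 ha'0 hab haP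
    exact Or.inl (mem_localizationSet_of_pow_mem hn ⟨a', b', hbP, hpow⟩)
  · exact Or.inr (mem_localizationSet_of_pow_mem hn ⟨b', a', haP, by rw [inv_pow, hpow, inv_div]⟩)

/-- Let `b'` be the reduced denominator of a power of `x = a / b`. If it were a nonunit, it would
lie in a packet with radical `P` of height one, and `x ∈ D_P` would force the coprime numerator `a'`
into `P` too. So `b'` is a unit and `bⁿ ∣ aⁿ`. -/
theorem exists_algebraMap_eq_of_forall_mem_localizationSet [IsIntegrallyClosed D]
    (hA : IsAGCDDomain D) (hU : IsURD D K)
    (hH : ∀ I : Ideal D, IsPacket D K I → I.radical.height = 1) {x : K}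
    (hx : ∀ P : Ideal D, P.IsPrime → P.height = 1 → x ∈ localizationSet K P) :
    ∃ y : D, algebraMap D K y = x := by
  by_cases hx0 : x = 0
  · exact ⟨0, by rw [hx0, map_zero]⟩
  obtain ⟨a, b, hb, rfl⟩ := IsFractionRing.div_surjective D x
  have hb0 := nonZeroDivisors.ne_zero hb
  have ha0 : a ≠ 0 := by rintro rfl; simp at hx0
  obtain ⟨n, hn, d, b', a', hb, ha, hba⟩ := hA.exists_pow_eq_mul hb0 ha0
  have hb'0 : b' ≠ 0 := by rintro rfl; exact pow_ne_zero n hb0 (by rw [hb, mul_zero])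
  have hbu : IsUnit b' := by
    by_contra hbu
    obtain ⟨s, ⟨I, hIs⟩, hs, -⟩ := hU.exists_packets hb'0 hbu
    obtain ⟨hI, hbI⟩ := hs I hIs
    have hP := hI.2.2
    obtain ⟨c, t, ht, hct⟩ := hx I.radical hP (hH I hI)
    have ht0 : t ≠ 0 := fun h0 => ht (h0 ▸ zero_mem _)
    have hbK : algebraMap D K b ≠ 0 := by simpa using hb0
    have htK : algebraMap D K t ≠ 0 := by simpa using ht0
    rw [div_eq_div_iff hbK htK] at hct
    have h1 : a * t = c * b := IsFractionRing.injective D K (by rw [map_mul, map_mul, hct])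
    have hd0 : d ≠ 0 := by rintro rfl; exact pow_ne_zero n hb0 (by rw [hb, zero_mul])
    have h2 : a' * t ^ n = c ^ n * b' := by
      apply mul_left_cancel₀ hd0
      rw [← mul_assoc, ← ha, ← mul_pow, h1, mul_pow, hb]
      ring
    have h3 : a' * t ^ n ∈ I.radical := h2 ▸ Ideal.mul_mem_left _ _ (Ideal.le_radical hbI)
    have h4 : a' ∈ I.radical :=
      (hP.mem_or_mem h3).resolve_right fun h => ht (hP.mem_of_pow_mem n h)
    exact notMem_of_height_eq_one hA hU (hH I hI) hb'0 hba (Ideal.le_radical hbI) h4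
  have hdvd : b ∣ a := by
    refine (IsIntegrallyClosed.pow_dvd_pow_iff (n := n) (by omega)).1 ?_
    rw [ha, hb]
    exact hbu.mul_right_dvd.2 (dvd_mul_right _ _)
  obtain ⟨y, rfl⟩ := hdvd
  refine ⟨y, ?_⟩
  rw [map_mul, mul_div_cancel_left₀]
  simpa using hb0

theorem isGeneralizedKrullDomain_of_height_radical [IsIntegrallyClosed D] (hA : IsAGCDDomain D)
    (hU : IsURD D K) (hH : ∀ I : Ideal D, IsPacket D K I → I.radical.height = 1) :
    IsGeneralizedKrullDomain D K := by
  have hloc : ∀ P : Ideal D, P.IsPrime → ∀ d : D, algebraMap D K d ∈ localizationSet K P :=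
    fun P hP d => ⟨d, 1, (Ideal.ne_top_iff_one P).1 hP.ne_top, by simp⟩
  refine ⟨{V | ∃ P : Ideal D, P.IsPrime ∧ P.height = 1 ∧ (V : Set K) = localizationSet K P},
    ?_, ?_, ?_⟩
  · rintro V ⟨P, hP, hP1, hV⟩
    refine ⟨?_, P, hP, hV⟩
    have h := mem_or_inv_mem_localizationSet hA hU hP1
    obtain rfl : V = ValuationSubring.ofLocalization K P h :=
      SetLike.coe_injective (by rw [hV, ValuationSubring.coe_ofLocalization])
    rw [ValuationSubring.IsRankOne, ValuationSubring.ringKrullDim_ofLocalization, hP1]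
    rfl
  · refine le_antisymm (fun x hx => ?_) ?_
    · refine exists_algebraMap_eq_of_forall_mem_localizationSet hA hU hH fun P hP hP1 => ?_
      have h := mem_or_inv_mem_localizationSet hA hU hP1
      rw [← ValuationSubring.coe_ofLocalization P h]
      exact Subring.mem_iInf.1 (Subring.mem_iInf.1 hx (ValuationSubring.ofLocalization K P h))
        ⟨P, hP, hP1, ValuationSubring.coe_ofLocalization P h⟩
    · rintro _ ⟨d, rfl⟩
      refine Subring.mem_iInf.2 fun V => Subring.mem_iInf.2 fun ⟨P, hP, _, hV⟩ => ?_
      have : algebraMap D K d ∈ (V : Set K) := hV ▸ hloc P hP d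
      exact this
  · intro x hx
    -- If `x ∉ P`, then `x` is a unit in `D_P`, so only the finitely many height-one primes
    -- containing `x` matter.
    refine (((finite_setOf_height_eq_one_mem hU hx).image (localizationSet K)).preimage
      SetLike.coe_injective.injOn).subset ?_
    rintro V ⟨⟨P, hP, hP1, hV⟩, hVx⟩
    refine ⟨P, ⟨hP, hP1, ?_⟩, hV.symm⟩
    by_contra hxP
    have hxK : algebraMap D K x ≠ 0 := by simpa using hx
    have h1 : algebraMap D K x ∈ (V : Set K) := hV ▸ hloc P hP x
    have h2 : (algebraMap D K x)⁻¹ ∈ (V : Set K) := hV ▸ ⟨1, x, hxP, by simp⟩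
    refine hVx (le_antisymm ((V.valuation_le_one_iff _).2 h1) ?_)
    have h3 := (V.valuation_le_one_iff _).2 h2
    rwa [map_inv₀, inv_le_one₀ (zero_lt_iff.2 ((_root_.map_ne_zero _).2 hxK))] at h3

end

end

/-! ### The cycle of implications -/

theorem theorem4p7 (D K : Type*) [CommRing D] [IsDomain D] [Field K] [Algebra D K]
    [IsFractionRing D K] (hAGCD : IsAGCDDomain D) (hURD : IsURD D K) :
    List.TFAE [
      ∃ 𝓥 : Set (ValuationSubring K), (∀ V ∈ 𝓥, V.IsRankOne) ∧ IsIntersectionOf D K 𝓥 ∧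
        IsLocallyFiniteFamily D K 𝓥,
      ∃ 𝓥 : Set (ValuationSubring K), (∀ V ∈ 𝓥, V.IsRankOne) ∧ IsIntersectionOf D K 𝓥,
      completeIntegralClosure D K = ⊥,
      IsIntegrallyClosed (PowerSeries D),
      IsIntegrallyClosed D ∧ IsArchimedeanDomain D,
      IsIntegrallyClosed D ∧ ∀ I : Ideal D, IsPacket D K I →
        ∃ P : Ideal D, P.IsPrime ∧ P.height = 1 ∧ I ≤ P,
      IsAlmostGUFD D K] := by
  tfae_have 1 → 2 := fun ⟨𝓥, h1, h2, _⟩ => ⟨𝓥, h1, h2⟩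
  tfae_have 2 → 3 := fun ⟨_, h1, h2⟩ => completeIntegralClosure_eq_bot_of_isIntersectionOf h1 h2
  tfae_have 3 → 4 := PowerSeries.isIntegrallyClosed_of_completeIntegralClosure_eq_bot
  tfae_have 4 → 5 := fun _ => ⟨PowerSeries.isIntegrallyClosed_of_isIntegrallyClosed D,
    PowerSeries.isArchimedeanDomain_of_isIntegrallyClosed D⟩
  tfae_have 5 → 6 := fun ⟨h1, h2⟩ => ⟨h1, fun I hI => ⟨I.radical, hI.2.2,
    hI.height_radical_of_isArchimedeanDomain hAGCD hURD h2, Ideal.le_radical⟩⟩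
  tfae_have 6 → 7 := by
    rintro ⟨_, h⟩
    refine ⟨isGeneralizedKrullDomain_of_height_radical hAGCD hURD fun I hI => ?_,
      isMulTorsion_tClassGroup hAGCD⟩
    obtain ⟨P, hP, hP1, hIP⟩ := h I hI
    have := hI.2.2
    rw [Ideal.eq_of_le_of_height_eq_one hI.radical_ne_bot (hP.radical_le_iff.2 hIP) hP1, hP1]
  tfae_have 7 → 1 := fun ⟨⟨𝓥, h1, h2, h3⟩, _⟩ => ⟨𝓥, fun V hV => (h1 V hV).1, h2, h3⟩
  tfae_finish
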